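/- Let $X$ be a zero-dimensional Hausdorff space, i.e. a Hausdorff topological space with a basis consisting of clopen sets. Let $\mathbb{I}(X)$ denote the set of isolated points of $X$, let $C^F(X)$ denote the ring of all continuous functions $X\to\mathbb{R}$ with finite image, and let $C_F(X)$ denote its ideal of all continuous functions $X\to\mathbb{R}$ with finite support. A commutative ring $R$ is called self-injective if every $R$-module homomorphism $I\to R$, where $I$ is an ideal of $R$, extends to an $R$-module homomorphism $R\to R$. Then the factor ring $C^F(X)/C_F(X)$ is self-injective if and only if $X$ is compact and $X\setminus\mathbb{I}(X)$ is finite. -/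

import Mathlib

/-- A commutative ring `R` is self-injective if every `R`-linear map `I → R` from an ideal `I` of
`R` extends to an `R`-linear map `R → R`. -/
def IsSelfInjective (R : Type*) [CommRing R] : Prop :=
  Module.Baer R R

/-- A topological space is zero-dimensional if its clopen subsets form a basis. -/
def IsZeroDimensional (X : Type*) [TopologicalSpace X] : Prop :=
  TopologicalSpace.IsTopologicalBasis {s : Set X | IsClopen s}

/-- The set `𝕀(X)` of isolated points of `X`. -/
def isolatedPts (X : Type*) [TopologicalSpace X] : Set X :=
  {x | IsOpen {x}}

/-- `C^F(X)`: the ring of continuous real-valued functions on `X` with finite image. -/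
def finiteImageSubring (X : Type*) [TopologicalSpace X] : Subring C(X, ℝ) where
  carrier := {f | (Set.range f).Finite}
  mul_mem' {f g} hf hg := by
    refine (Set.Finite.image2 (· * ·) hf hg).subset ?_
    rintro _ ⟨x, rfl⟩
    exact ⟨f x, ⟨x, rfl⟩, g x, ⟨x, rfl⟩, rfl⟩
  one_mem' := (Set.finite_singleton (1 : ℝ)).subset (by rintro _ ⟨x, rfl⟩; rfl)
  add_mem' {f g} hf hg := by
    refine (Set.Finite.image2 (· + ·) hf hg).subset ?_
    rintro _ ⟨x, rfl⟩
    exact ⟨f x, ⟨x, rfl⟩, g x, ⟨x, rfl⟩, rfl⟩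
  zero_mem' := (Set.finite_singleton (0 : ℝ)).subset (by rintro _ ⟨x, rfl⟩; rfl)
  neg_mem' {f} hf := by
    refine (Set.Finite.image (fun t => -t) hf).subset ?_
    rintro _ ⟨x, rfl⟩
    exact ⟨f x, ⟨x, rfl⟩, rfl⟩

/-- `C_F(X)`: the ideal of continuous real-valued functions on `X` with finite support, that is,
which vanish outside a finite set. -/
def finiteSupportIdeal (X : Type*) [TopologicalSpace X] : Ideal C(X, ℝ) where
  carrier := {f | (Function.support f).Finite}
  add_mem' {f g} hf hg := (Set.Finite.union hf hg).subset (Function.support_add f g)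
  zero_mem' := by simp
  smul_mem' c f hf := Set.Finite.subset hf (by
    intro x hx h0
    exact hx (by simp [h0]))

/-- A function with finite support has finite image, so `C_F(X) ⊆ C^F(X)`. -/
theorem finiteSupportIdeal_subset_finiteImageSubring (X : Type*) [TopologicalSpace X] :
    (finiteSupportIdeal X : Set C(X, ℝ)) ⊆ finiteImageSubring X := by
  intro f hf
  refine ((Set.Finite.image f hf).insert 0).subset ?_
  rintro _ ⟨x, rfl⟩
  by_cases h : f x = 0
  · exact Or.inl h
  · exact Or.inr ⟨x, h, rfl⟩

/-- `C_F(X)` as an ideal of the ring `C^F(X)`. -/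
def finiteSupportIdealInFiniteImage (X : Type*) [TopologicalSpace X] :
    Ideal (finiteImageSubring X) :=
  (finiteSupportIdeal X).comap (finiteImageSubring X).subtype

/-! Self-injectivity glues multipliers over orthogonal idempotents. Infinite disjoint clopen sets `U
n` would give such idempotents modulo `C_F(X)`; gluing the constants `n` yields `f` equal to `n` on
`U n` off a finite set, contradicting finite image. Infinitely many non-isolated points would
produce such `U n`, and so would an infinite closed set of isolated points; excluding both forces
compactness. Conversely, restriction to the finitely many non-isolated points identifies the
quotient with a finite power of `ℝ`, which is semisimple. -/

open Set

/-- In a self-injective ring, any prescription `a n` of multipliers on a sequence of orthogonal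
idempotents is realised by a single ring element. -/
theorem IsSelfInjective.exists_mul_eq_mul {R : Type*} [CommRing R] (h : IsSelfInjective R)
    (e a : ℕ → R) (he : ∀ n, e n * e n = e n) (horth : ∀ m n, m ≠ n → e m * e n = 0) :
    ∃ r, ∀ n, r * e n = a n * e n := by
  -- Elements killed by almost all `e n`: `x ↦ ∑ a n * e n * x` is then a finite sum, and
  -- orthogonality puts each `e n` in `I`.
  let I : Ideal R :=
    { carrier := {x | (Function.support fun n => e n * x).Finite}
      add_mem' := fun {x y} hx hy => (Set.Finite.union hx hy).subset (by
        simpa only [mul_add] using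
          Function.support_add (fun n => e n * x) (fun n => e n * y))
      zero_mem' := by simp
      smul_mem' := fun c x hx => Set.Finite.subset hx (by
        intro n hn h0
        apply hn
        simp only at h0
        simp only [smul_eq_mul]
        rw [mul_left_comm, h0, mul_zero]) }
  have hsupp : ∀ x : I, (Function.support fun n => a n * (e n * (x : R))).Finite := fun x =>
    Set.Finite.subset x.2 (Function.support_mul_subset_right _ _)
  let φ : I →ₗ[R] R :=
    { toFun := fun x => ∑ᶠ n, a n * (e n * (x : R))
      map_add' := fun x y => by
        rw [← finsum_add_distrib (hsupp x) (hsupp y)]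
        simp [mul_add]
      map_smul' := fun c x => by
        simp only [RingHom.id_apply, smul_eq_mul, Submodule.coe_smul]
        rw [mul_finsum' _ _ (hsupp x)]
        exact finsum_congr fun n => by ring }
  obtain ⟨g, hg⟩ := h I φ
  refine ⟨g 1, fun n => ?_⟩
  have hmem : e n ∈ I := (Set.finite_singleton n).subset fun m hm => by
    by_contra hmn
    exact hm (horth m n hmn)
  have hgn := hg (e n) hmem
  have hφ : φ ⟨e n, hmem⟩ = a n * (e n * e n) := by
    refine finsum_eq_single _ n fun m hm => ?_
    simp only
    rw [horth m n hm, mul_zero]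
  rw [hφ, he] at hgn
  rw [← hgn, mul_comm, ← smul_eq_mul, ← map_smul, smul_eq_mul, mul_one]

section

variable {X : Type*} [TopologicalSpace X]

/-- The function equal to `c` on the clopen set `U` and to `0` elsewhere. -/
noncomputable def clopenIndicator {U : Set X} (hU : IsClopen U) (c : ℝ) :
    finiteImageSubring X :=
  ⟨⟨U.indicator fun _ => c, hU.continuous_indicator continuous_const⟩, by
    refine (Set.toFinite {0, c}).subset ?_
    rintro _ ⟨x, rfl⟩
    by_cases hx : x ∈ U <;> simp [hx]⟩

@[simp]
theorem clopenIndicator_apply {U : Set X} (hU : IsClopen U) (c : ℝ) (x : X) :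
    (clopenIndicator hU c : C(X, ℝ)) x = U.indicator (fun _ => c) x :=
  rfl

theorem mk_finiteSupportIdeal_eq_iff {f g : finiteImageSubring X} :
    Ideal.Quotient.mk (finiteSupportIdealInFiniteImage X) f = Ideal.Quotient.mk _ g ↔
      {x | (f : C(X, ℝ)) x ≠ (g : C(X, ℝ)) x}.Finite := by
  rw [Ideal.Quotient.eq]
  change (Function.support ((f : C(X, ℝ)) - (g : C(X, ℝ)))).Finite ↔ _
  have : Function.support ((f : C(X, ℝ)) - (g : C(X, ℝ))) =
      {x | (f : C(X, ℝ)) x ≠ (g : C(X, ℝ)) x} := by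
    ext x
    simp [sub_eq_zero]
  rw [this]

theorem exists_finite_of_isSelfInjective
    (h : IsSelfInjective (finiteImageSubring X ⧸ finiteSupportIdealInFiniteImage X))
    (U : ℕ → Set X) (hU : ∀ n, IsClopen (U n)) (hd : Pairwise (Function.onFun Disjoint U)) :
    ∃ n, (U n).Finite := by
  by_contra! hinf
  let q := Ideal.Quotient.mk (finiteSupportIdealInFiniteImage X)
  obtain ⟨r, hr⟩ := h.exists_mul_eq_mul (fun n => q (clopenIndicator (hU n) 1))
    (fun n => q (n : finiteImageSubring X))
    (fun n => by
      rw [← map_mul]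
      congr 1
      ext x
      by_cases hx : x ∈ U n <;> simp [hx])
    (fun m n hmn => by
      rw [← map_mul, ← map_zero q]
      congr 1
      ext x
      by_cases hx : x ∈ U m
      · have : x ∉ U n := Set.disjoint_left.1 (hd hmn) hx
        simp [this]
      · simp [hx])
  obtain ⟨f, rfl⟩ := Ideal.Quotient.mk_surjective r
  have key : ∀ n : ℕ, (n : ℝ) ∈ Set.range (f : C(X, ℝ)) := by
    intro n
    have hn := hr n
    simp only [q] at hn
    rw [← map_mul, ← map_mul, mk_finiteSupportIdeal_eq_iff] at hn
    obtain ⟨x, hxU, hx⟩ := (hinf n).exists_notMem_finite hn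
    exact ⟨x, by simpa [hxU] using hx⟩
  exact (Set.infinite_range_of_injective (Nat.cast_injective (R := ℝ)))
    (f.2.subset (by rintro _ ⟨n, rfl⟩; exact key n))

theorem IsZeroDimensional.exists_isClopen (hX : IsZeroDimensional X) {x : X} {O : Set X}
    (hO : IsOpen O) (hx : x ∈ O) : ∃ U, IsClopen U ∧ x ∈ U ∧ U ⊆ O := by
  obtain ⟨U, hU, hxU, hUO⟩ := hX.exists_subset_of_mem_open hx hO
  exact ⟨U, hU, hxU, hUO⟩

theorem infinite_of_isOpen_of_notMem_isolatedPts [T1Space X] {x : X} (hx : x ∉ isolatedPts X)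
    {O : Set X} (hO : IsOpen O) (hxO : x ∈ O) : O.Infinite := by
  intro hfin
  apply hx
  have : {x} = O \ (O \ {x}) := by
    ext y
    simp only [mem_singleton_iff, mem_sdiff]
    constructor
    · rintro rfl
      exact ⟨hxO, by simp⟩
    · rintro ⟨h1, h2⟩
      by_contra h
      exact h2 ⟨h1, h⟩
  change IsOpen {x}
  rw [this]
  exact hO.sdiff (hfin.subset sdiff_subset).isClosed

theorem exists_seq_isClopen_infinite_pairwise_disjoint [T2Space X] (hX : IsZeroDimensional X)
    (hP : ((isolatedPts X)ᶜ).Infinite) :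
    ∃ U : ℕ → Set X, (∀ n, IsClopen (U n)) ∧ (∀ n, (U n).Infinite) ∧
      Pairwise (Function.onFun Disjoint U) := by
  have := hP.to_subtype
  obtain ⟨V, hVinf, hVo, hVd⟩ :=
    exists_seq_infinite_isOpen_pairwise_disjoint (X := ((isolatedPts X)ᶜ : Set X))
  choose p hp using fun n => (hVinf n).nonempty
  choose O hO hOV using fun n => isOpen_induced_iff.1 (hVo n)
  have hpO : ∀ n, (p n : X) ∈ O n := fun n => by
    have := hp n
    rwa [← hOV n] at this
  choose C hC hpC hCO using fun n => hX.exists_isClopen (hO n) (hpO n)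
  -- The `C n` may overlap at isolated points. Disjointing them keeps `p n`, since `V n` is disjoint
  -- from earlier `V m`.
  have hclopen : ∀ n, IsClopen (disjointed C n) := fun n =>
    disjointedRec (p := IsClopen) (fun _ i ht => ht.diff (hC i)) (hC n)
  refine ⟨disjointed C, hclopen, fun n => ?_, disjoint_disjointed C⟩
  refine infinite_of_isOpen_of_notMem_isolatedPts (p n).2 (hclopen n).isOpen ?_
  rw [disjointed_eq_inter_compl]
  refine ⟨hpC n, mem_iInter₂.2 fun m hm hmem => ?_⟩
  have hpm : p n ∈ V m := by
    rw [← hOV m]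
    exact hCO m hmem
  exact Set.disjoint_left.1 (hVd hm.ne) hpm (hp n)

theorem isOpen_of_subset_isolatedPts {A : Set X} (hA : A ⊆ isolatedPts X) : IsOpen A := by
  rw [← biUnion_of_singleton A]
  exact isOpen_biUnion fun x hx => hA hx

theorem isClopen_of_subset_isClosed_subset_isolatedPts {A D : Set X} (hD : IsClosed D)
    (hDI : D ⊆ isolatedPts X) (hA : A ⊆ D) : IsClopen A := by
  refine ⟨⟨?_⟩, isOpen_of_subset_isolatedPts (hA.trans hDI)⟩
  have : Aᶜ = Dᶜ ∪ (D \ A) := by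
    ext x
    have := @hA x
    simp only [mem_compl_iff, mem_union, mem_sdiff]
    tauto
  rw [this]
  exact hD.isOpen_compl.union (isOpen_of_subset_isolatedPts (sdiff_subset.trans hDI))

theorem Set.Infinite.exists_seq_infinite_subset_pairwise_disjoint {α : Type*} {D : Set α}
    (hD : D.Infinite) :
    ∃ U : ℕ → Set α, (∀ n, U n ⊆ D) ∧ (∀ n, (U n).Infinite) ∧
      Pairwise (Function.onFun Disjoint U) := by
  let g : ℕ × ℕ → α := fun k => hD.natEmbedding D (Nat.pairEquiv k)
  have hg : Function.Injective g :=
    Subtype.val_injective.comp ((hD.natEmbedding D).injective.comp Nat.pairEquiv.injective)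
  refine ⟨fun n => range fun k => g (n, k), ?_, ?_, ?_⟩
  · rintro n _ ⟨k, rfl⟩
    exact (hD.natEmbedding D _).2
  · exact fun n => infinite_range_of_injective (hg.comp (Prod.mk_right_injective n))
  · intro m n hmn
    refine Set.disjoint_left.2 ?_
    rintro _ ⟨k, rfl⟩ ⟨l, hl⟩
    exact hmn (congrArg Prod.fst (hg hl)).symm

/-- Finitely many members of a cover contain all non-isolated points; what they miss is closed and
consists of isolated points, hence is finite. -/
theorem compactSpace_of_finite_compl_isolatedPts (hP : ((isolatedPts X)ᶜ).Finite)
    (hfin : ∀ D : Set X, IsClosed D → D ⊆ isolatedPts X → D.Finite) : CompactSpace X := by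
  refine ⟨isCompact_of_finite_subcover fun {ι} U hUo hU => ?_⟩
  obtain ⟨t, ht⟩ := hP.isCompact.elim_finite_subcover U hUo ((subset_univ _).trans hU)
  have hD := hfin (⋃ i ∈ t, U i)ᶜ (isOpen_biUnion fun i _ => hUo i).isClosed_compl
    (compl_subset_comm.1 ht)
  obtain ⟨s, hs⟩ := hD.isCompact.elim_finite_subcover U hUo ((subset_univ _).trans hU)
  classical
  refine ⟨t ∪ s, fun x _ => ?_⟩
  rw [Finset.set_biUnion_union]
  by_cases hx : x ∈ ⋃ i ∈ t, U i
  · exact Or.inl hx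
  · exact Or.inr (hs hx)

/-- Restriction of functions in `C^F(X)` to the set of non-isolated points. -/
def restrictNonisolated (X : Type*) [TopologicalSpace X] :
    finiteImageSubring X →+* (((isolatedPts X)ᶜ : Set X) → ℝ) where
  toFun f p := (f : C(X, ℝ)) p
  map_one' := rfl
  map_mul' _ _ := rfl
  map_zero' := rfl
  map_add' _ _ := rfl

/-- The nonzero values form a finite, hence closed, set. -/
theorem isClopen_support (f : finiteImageSubring X) :
    IsClopen (Function.support (f : C(X, ℝ))) := by
  refine ⟨?_, (f : C(X, ℝ)).continuous.isOpen_support⟩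
  have : Function.support (f : C(X, ℝ)) =
      (f : C(X, ℝ)) ⁻¹' (range (f : C(X, ℝ)) \ {0}) := by
    ext x
    simp
  rw [this]
  exact (Set.Finite.subset f.2 sdiff_subset).isClosed.preimage (f : C(X, ℝ)).continuous

/-- A closed support made of isolated points is compact and discrete, hence finite; an open support
containing a non-isolated point is infinite. -/
theorem ker_restrictNonisolated [T1Space X] [CompactSpace X] :
    RingHom.ker (restrictNonisolated X) = finiteSupportIdealInFiniteImage X := by
  ext f
  rw [RingHom.mem_ker]
  change _ ↔ (Function.support (f : C(X, ℝ))).Finite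
  constructor
  · intro h
    have hsub : Function.support (f : C(X, ℝ)) ⊆ isolatedPts X := fun x hx => by
      by_contra hxI
      exact hx (congrFun h ⟨x, hxI⟩)
    obtain ⟨t, ht⟩ := (isClopen_support f).isClosed.isCompact.elim_finite_subcover
      (fun x : isolatedPts X => {(x : X)}) (fun x => x.2)
      (fun x hx => mem_iUnion.2 ⟨⟨x, hsub hx⟩, rfl⟩)
    exact (t.finite_toSet.biUnion fun x _ => finite_singleton (x : X)).subset ht
  · intro h
    funext p
    by_contra hp
    exact infinite_of_isOpen_of_notMem_isolatedPts p.2 (isClopen_support f).isOpen hp h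

theorem restrictNonisolated_surjective [T1Space X] (hX : IsZeroDimensional X)
    (hP : ((isolatedPts X)ᶜ).Finite) : Function.Surjective (restrictNonisolated X) := by
  classical
  intro c
  have := hP.fintype
  -- Clopen neighbourhoods of `p` avoiding the other non-isolated points; their indicators restrict
  -- to the standard basis.
  have hsep : ∀ p : ((isolatedPts X)ᶜ : Set X),
      ∃ U, IsClopen U ∧ (p : X) ∈ U ∧ U ⊆ ((isolatedPts X)ᶜ \ {(p : X)})ᶜ := fun p =>
    hX.exists_isClopen (hP.subset sdiff_subset).isClosed.isOpen_compl (by simp)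
  choose U hU hpU hUs using hsep
  refine ⟨∑ p, clopenIndicator (hU p) (c p), ?_⟩
  rw [map_sum]
  funext y
  rw [Finset.sum_apply, Finset.sum_eq_single y]
  · exact indicator_of_mem (hpU y) fun _ => c y
  · intro p _ hpy
    change (U p).indicator (fun _ => c p) (y : X) = 0
    refine indicator_of_notMem (fun hy => hUs p hy ⟨y.2, fun h => hpy ?_⟩) _
    exact (Subtype.ext h).symm
  · simp

end

theorem IsSemisimpleRing.isSelfInjective (R : Type*) [CommRing R] [IsSemisimpleRing R] :
    IsSelfInjective R :=
  Module.Baer.of_injective (Module.injective_of_isSemisimpleRing R R)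

theorem proposition4p7p5 (X : Type*) [TopologicalSpace X] [T2Space X]
    (hX : IsZeroDimensional X) :
    IsSelfInjective (finiteImageSubring X ⧸ finiteSupportIdealInFiniteImage X) ↔
      CompactSpace X ∧ ((isolatedPts X)ᶜ).Finite := by
  constructor
  · intro h
    have hP : ((isolatedPts X)ᶜ).Finite := by
      by_contra hP
      obtain ⟨U, hU, hinf, hd⟩ := exists_seq_isClopen_infinite_pairwise_disjoint hX hP
      obtain ⟨n, hn⟩ := exists_finite_of_isSelfInjective h U hU hd
      exact hinf n hn
    refine ⟨compactSpace_of_finite_compl_isolatedPts hP fun D hD hDI => ?_, hP⟩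
    by_contra hDinf
    obtain ⟨U, hUD, hinf, hd⟩ :=
      Set.Infinite.exists_seq_infinite_subset_pairwise_disjoint hDinf
    obtain ⟨n, hn⟩ := exists_finite_of_isSelfInjective h U
      (fun n => isClopen_of_subset_isClosed_subset_isolatedPts hD hDI (hUD n)) hd
    exact hinf n hn
  · rintro ⟨_, hP⟩
    have := hP.to_subtype
    have : IsSemisimpleRing (finiteImageSubring X ⧸ finiteSupportIdealInFiniteImage X) :=
      ((Ideal.quotEquivOfEq ker_restrictNonisolated.symm).trans
        (RingHom.quotientKerEquivOfSurjective
          (restrictNonisolated_surjective hX hP))).symm.isSemisimpleRing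
    exact IsSemisimpleRing.isSelfInjective _
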